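/- **Model.** Let $G=(V,E)$ be a finite simple graph on $n$ vertices and let $k\ge 2$. A Unique Games instance on $G$ with label set $[k]=\{0,\dots,k-1\}$ assigns to each edge $(u,v)$ a permutation $\pi_{uv}$ of $[k]$, with $\pi_{vu}=\pi_{uv}^{-1}$. Its label-extended graph has vertex set $V\times[k]$, and $(u,i),(v,j)$ are joined iff $(u,v)\in E$ and $\pi_{uv}(i)=j$. In the "random edges, adversarial constraints" model, an adversary picks $G$ and initial constraints that are all satisfied by the all-zero assignment, i.e. $\pi_{uv}(0)=0$ for all $(u,v)\in E$ (the planted assignment is the zero layer, without loss of generality). Each edge is put independently with probability $\varepsilon$ into a random set $E_\varepsilon$. Finally the adversary, knowing $E_\varepsilon$, replaces the constraints on the edges of $E_\varepsilon$ arbitrarily. **Crude SDP (C-SDP).** Minimize $$\sum_{(u,v)\in E}\ \sum_{i\in[k]}\tfrac12\|u_i-v_{\pi_{uv}(i)}\|^2$$ over real vectors $u_i$ ($u\in V$, $i\in[k]$) of any finite dimension, subject to $\|u_i\|=1$ for all $u,i$; $\langle u_i,u_{i'}\rangle=0$ for all $u$ and $i\ne i'$; and $\tfrac12\|u_i-v_j\|^2+\tfrac12\|u_{i'}-v_j\|^2\ge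 1$ for all adjacent $u,v$ (in both orders) and all $i\neq i'$, $j$. Fix a constant $c^*>0$. For a C-SDP solution $\{u_i\}$, an edge $((u,i),(v,j))$ of the label-extended graph is $\eta$-super short if $\|u_i-v_j\|^2\le c^*\eta^2/\log k$; $\Gamma_\eta$ is the set of all $\eta$-super short edges. All logarithms are to base $2$. **Theorem.** For every constant $c^*>0$ there is a constant $C>0$, depending only on $c^*$, such that for every $c\in(0,1)$ there is a sequence $\delta(n)\to 0$ (depending only on $c^*$ and $c$) with the following property. Let $k\in\mathbb N$ with $k\ge2$, $\varepsilon\in(0,1/3)$, $\eta\in(c,1)$, $\gamma\in(\varepsilon+c,1)$, and let $G=(V,E)$ be an arbitrary graph on $n$ vertices with $$|E|\ \ge\ C\,\eta^{-2}(\gamma-\varepsilon)^{-1}(1/3-\varepsilon)^{-4}\, n\,\log k\,\bigl(\log(c^{-1}\log k)\bigr)^2 .$$ Then, for any initial constraints as above, with probability at least $1-\delta(n)$ over the choice of $E_\varepsilon$ the following holds: for every choice of the new constraints on $E_\varepsilon$ and every optimal solution $\{u_i\}$ of the C-SDP of the resulting instance, the set $$\Gamma^0_\eta=\Gamma_\eta\cap\{((u,0),(v,0))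 : (u,v)\in E\}$$ contains at least $(1-\gamma)|E|$ edges. -/

import Mathlib

open scoped InnerProductSpace

/-- An instance of Unique Games on the constraint graph `G` with label set `Fin k`. An edge carries
one constraint, which is read as `perm u v` from `u` to `v` and as its inverse from `v` to `u`.
The values of `perm` at non-adjacent pairs play no role. -/
structure UniqueGame {V : Type*} (G : SimpleGraph V) (k : ℕ) where
  perm : V → V → Equiv.Perm (Fin k)
  perm_symm : ∀ u v, G.Adj u v → perm v u = (perm u v).symm

namespace UniqueGame

variable {V : Type*} {G : SimpleGraph V} {k : ℕ}

/-- The assignment `a` of labels satisfies every constraint. -/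
def SatisfiedBy (I : UniqueGame G k) (a : V → Fin k) : Prop :=
  ∀ u v, G.Adj u v → I.perm u v (a u) = a v

/-- `J` arises from `I` by replacing the constraints of the edges in `F` in an arbitrary way. -/
def IsCorruption (I : UniqueGame G k) (F : Set (Sym2 V)) (J : UniqueGame G k) : Prop :=
  ∀ u v, G.Adj u v → s(u, v) ∉ F → J.perm u v = I.perm u v

/-- The label-extended graph. -/
def labelExtended (I : UniqueGame G k) : SimpleGraph (V × Fin k) where
  Adj p q := G.Adj p.1 q.1 ∧ I.perm p.1 q.1 p.2 = q.2
  symm := ⟨by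
    rintro ⟨u, i⟩ ⟨v, j⟩ ⟨h, hij⟩
    refine ⟨h.symm, ?_⟩
    dsimp only at h hij ⊢
    rw [I.perm_symm u v h, ← hij, Equiv.symm_apply_apply]⟩
  loopless := ⟨fun p h => G.loopless.irrefl p.1 h.1⟩

section CrudeSDP

variable {E : Type*} [NormedAddCommGroup E] [InnerProductSpace ℝ E]

/-- The constraints of the Crude SDP for a system of vectors `x u i`. -/
structure CrudeFeasible (_I : UniqueGame G k) (x : V → Fin k → E) : Prop where
  norm_eq_one : ∀ u i, ‖x u i‖ = 1
  orthogonal : ∀ u i i', i ≠ i' → ⟪x u i, x u i'⟫_ℝ = 0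
  triangle : ∀ u v, G.Adj u v → ∀ i i' j, i ≠ i' →
    1 ≤ (1 / 2) * ‖x u i - x v j‖ ^ 2 + (1 / 2) * ‖x u i' - x v j‖ ^ 2

open Classical in
/-- The objective of the Crude SDP: the sum over the edges `(u, v)` and the labels `i` of
`‖x u i - x v (π_uv i)‖² / 2`. The double sum below meets every edge in both orientations, with
equal contributions, which the outer factor `1 / 2` undoes. -/
noncomputable def crudeValue [Fintype V] (I : UniqueGame G k) (x : V → Fin k → E) : ℝ :=
  (1 / 2) * ∑ u, ∑ v, if G.Adj u v then ∑ i, ‖x u i - x v (I.perm u v i)‖ ^ 2 / 2 else 0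

/-- The `η`-super short edges of the label-extended graph with respect to the vectors `x`, for the
constant `cstar`. -/
def superShort (I : UniqueGame G k) (cstar η : ℝ) (x : V → Fin k → E) :
    Set (Sym2 (V × Fin k)) :=
  {e | ∃ p q : V × Fin k, e = s(p, q) ∧ I.labelExtended.Adj p q ∧
    ‖x p.1 p.2 - x q.1 q.2‖ ^ 2 ≤ cstar * η ^ 2 / Real.logb 2 k}

/-- The super short edges that belong to the zero layer. -/
def superShortZero [NeZero k] (I : UniqueGame G k) (cstar η : ℝ) (x : V → Fin k → E) :
    Set (Sym2 (V × Fin k)) :=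
  I.superShort cstar η x ∩ {e | ∃ u v, G.Adj u v ∧ e = s((u, (0 : Fin k)), (v, (0 : Fin k)))}

end CrudeSDP

/-- An optimal solution of the Crude SDP. The dimension of the vectors is not restricted: the
competitors live in Euclidean spaces of all dimensions. -/
def CrudeOptimal [Fintype V] (I : UniqueGame G k) {d : ℕ}
    (x : V → Fin k → EuclideanSpace ℝ (Fin d)) : Prop :=
  I.CrudeFeasible x ∧
    ∀ (d' : ℕ) (y : V → Fin k → EuclideanSpace ℝ (Fin d')), I.CrudeFeasible y →
      I.crudeValue x ≤ I.crudeValue y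

end UniqueGame

/-! Replace all zero-layer vectors of an optimal solution by one new unit vector orthogonal to
everything else. Let d be the squared length of an edge in the zero layer. An uncorrupted edge saves
d/2, and a corrupted edge loses at most d by the triangle constraints. Optimality therefore forces
the corrupted edges to carry at least a third of the total zero-layer length
(`CrudeOptimal.sum_edgeSq_nonneg`). If too few zero-layer edges are super short, that total is at
least τ|E| (`mul_card_sub_le_sum_edgeSq`).

For one fixed vector system this is unlikely, because a random set of density ε < 1/3 carries about
an ε fraction of the length. The adversary acts after seeing the random set, so all unit vector
systems must be excluded at once. A system that violates the inequality is projected to a line by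
random signs, truncated at M and rounded to a grid (`exists_real_sum_edgeSq_ge`,
`exists_grid_sum_edgeSq_ge`). The violation survives with a smaller margin. Only K^n grid systems
exist, where K does not depend on the dimension, so the Chernoff bound and a union bound finish
(`exists_unlikely_of_unit_vectors`). The hypothesis on |E| pays for n log K, except when k = 2 and c
is near 1; there a direct count suffices. -/

/-! ### Exponential moments of Bernoulli random sets -/

section SetBernoulli

open ProbabilityTheory MeasureTheory

/-- A Markov inequality for random sets: the weight `∏_{e ∈ F} a e * ∏_{e ∈ E \ F} b e` has
expectation `∏_{e ∈ E} (p * a e + (1 - p) * b e)`. -/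
theorem mul_setBernoulli_real_le_prod {α : Type*} [Finite α] [DecidableEq α] (E : Finset α)
    (p : unitInterval) (S : Set (Set α)) (a b : α → ℝ) (ha : ∀ e, 0 ≤ a e) (hb : ∀ e, 0 ≤ b e)
    (y : ℝ) (hS : ∀ F ⊆ E, (F : Set α) ∈ S → y ≤ (∏ e ∈ F, a e) * ∏ e ∈ E \ F, b e) :
    y * (setBernoulli (E : Set α) p).real S ≤ ∏ e ∈ E, ((p : ℝ) * a e + (1 - p) * b e) := by
  classical
  have hp0 : (0 : ℝ) ≤ p := p.2.1
  have hp1 : (0 : ℝ) ≤ 1 - p := by linarith [p.2.2]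
  have hsum : (setBernoulli (E : Set α) p).real S =
      ∑ F ∈ E.powerset.filter (fun F : Finset α => (F : Set α) ∈ S), (p : ℝ) ^ F.card * (1 - p) ^ (E \ F).card := by
    have hset : {s ∈ S | s ⊆ (E : Set α)} =
        ⋃ F ∈ E.powerset.filter (fun F : Finset α => (F : Set α) ∈ S), {(F : Set α)} := by
      ext s
      simp only [Set.mem_ofPred_eq, Finset.mem_filter, Finset.mem_powerset, Set.mem_iUnion,
        Set.mem_singleton_iff, exists_prop]
      constructor
      · rintro ⟨hs, hsE⟩
        obtain ⟨F, rfl⟩ := (E.finite_toSet.subset hsE).exists_finset_coe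
        exact ⟨F, ⟨Finset.coe_subset.1 hsE, hs⟩, rfl⟩
      · rintro ⟨F, ⟨hF, hs⟩, rfl⟩
        exact ⟨hs, Finset.coe_subset.2 hF⟩
    rw [measureReal_def, setBernoulli_apply_eq_apply_subsets, ← measureReal_def, hset,
      measureReal_biUnion_finset]
    · refine Finset.sum_congr rfl fun F hF => ?_
      have hFE := Finset.mem_powerset.1 (Finset.mem_filter.1 hF).1
      rw [setBernoulli_real_singleton p (Finset.coe_subset.2 hFE) E.finite_toSet,
        ← Finset.coe_sdiff, Set.ncard_coe_finset, Set.ncard_coe_finset]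
    · intro F _ F' _ hne
      simpa [Function.onFun] using hne
    · exact fun F _ => Set.Finite.measurableSet (Set.finite_singleton _)
  -- The product of sums expands over all subsets of `E`; the terms outside `S` are nonnegative and
  -- get dropped.
  rw [hsum, Finset.mul_sum, Finset.prod_add]
  calc _ ≤ ∑ F ∈ E.powerset.filter (fun F : Finset α => (F : Set α) ∈ S),
        (∏ e ∈ F, (p : ℝ) * a e) * ∏ e ∈ E \ F, (1 - (p : ℝ)) * b e := by
        refine Finset.sum_le_sum fun F hF => ?_
        obtain ⟨hFE, hFS⟩ := Finset.mem_filter.1 hF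
        rw [Finset.prod_mul_distrib, Finset.prod_mul_distrib, Finset.prod_const, Finset.prod_const]
        have h := mul_le_mul_of_nonneg_right (hS F (Finset.mem_powerset.1 hFE) hFS)
          (mul_nonneg (pow_nonneg hp0 F.card) (pow_nonneg hp1 (E \ F).card))
        linarith
    _ ≤ _ := Finset.sum_le_sum_of_subset_of_nonneg (Finset.filter_subset _ _) fun F _ _ =>
        mul_nonneg (Finset.prod_nonneg fun e _ => mul_nonneg hp0 (ha e))
          (Finset.prod_nonneg fun e _ => mul_nonneg hp1 (hb e))

/-- The exponential moment of a centred Bernoulli variable with a negative drift. -/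
theorem bernoulli_exp_moment_le_one {p θ D d : ℝ} (hp0 : 0 ≤ p) (hp1 : p ≤ 1) (hθ0 : 0 < θ)
    (hθ1 : θ ≤ 1) (hD : 0 < D) (hd0 : 0 ≤ d) (hdD : d ≤ D) :
    p * Real.exp (θ / (2 * D) * ((1 - (p + θ / 2)) * d)) +
      (1 - p) * Real.exp (θ / (2 * D) * ((0 - (p + θ / 2)) * d)) ≤ 1 := by
  set x : ℝ := θ / (2 * D) * d with hx
  have hx0 : 0 ≤ x := by positivity
  have hxθ : x ≤ θ / 2 := by
    rw [hx, div_mul_eq_mul_div, div_le_div_iff₀ (by positivity) (by positivity)]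
    nlinarith
  have h1 : Real.exp x ≤ 1 + x + x ^ 2 := by
    have := (abs_le.1 (Real.abs_exp_sub_one_sub_id_le (x := x)
      (by rw [abs_of_nonneg hx0]; linarith))).2
    linarith
  have e1 : θ / (2 * D) * ((1 - (p + θ / 2)) * d) = x + -((p + θ / 2) * x) := by rw [hx]; ring
  have e2 : θ / (2 * D) * ((0 - (p + θ / 2)) * d) = -((p + θ / 2) * x) := by rw [hx]; ring
  rw [e1, e2, Real.exp_add]
  -- The drift θ/2 pays for the second-order term: p x² ≤ (θ/2) x, since p ≤ 1 and x ≤ θ/2.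
  have h2 : p * Real.exp x + (1 - p) ≤ Real.exp ((p + θ / 2) * x) := by
    refine le_trans ?_ (Real.add_one_le_exp _)
    have : p * x ^ 2 ≤ θ / 2 * x := by
      have h3 : p * x ^ 2 ≤ x ^ 2 := by nlinarith [sq_nonneg x]
      nlinarith
    nlinarith [mul_le_mul_of_nonneg_left h1 hp0]
  have h4 := mul_le_mul_of_nonneg_right h2 (Real.exp_pos (-((p + θ / 2) * x))).le
  rw [← Real.exp_add, add_neg_cancel, Real.exp_zero] at h4
  linarith

/-- A Chernoff bound for the weighted excess of a random set over its mean. -/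
theorem setBernoulli_real_excess_le {α : Type*} [Finite α] (E : Finset α) (p : unitInterval)
    {θ D : ℝ} (hθ0 : 0 < θ) (hθ1 : θ ≤ 1) (hD : 0 < D) (d : α → ℝ) (hd0 : ∀ e, 0 ≤ d e)
    (hdD : ∀ e, d e ≤ D) (t : ℝ) :
    (setBernoulli (E : Set α) p).real
      {F | t ≤ ∑ e ∈ E, (F.indicator (fun _ => (1 : ℝ)) e - (p + θ / 2)) * d e} ≤
        Real.exp (-(θ / (2 * D) * t)) := by
  classical
  have key := mul_setBernoulli_real_le_prod E p
    {F | t ≤ ∑ e ∈ E, (F.indicator (fun _ => (1 : ℝ)) e - (p + θ / 2)) * d e}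
    (fun e => Real.exp (θ / (2 * D) * ((1 - (p + θ / 2)) * d e)))
    (fun e => Real.exp (θ / (2 * D) * ((0 - (p + θ / 2)) * d e)))
    (fun e => (Real.exp_pos _).le) (fun e => (Real.exp_pos _).le)
    (Real.exp (θ / (2 * D) * t)) (by
      intro F hF hFS
      rw [← Real.exp_sum, ← Real.exp_sum, ← Real.exp_add, Real.exp_le_exp]
      rw [Set.mem_ofPred_eq, ← Finset.sum_sdiff hF, add_comm] at hFS
      rw [← Finset.mul_sum F, ← Finset.mul_sum (E \ F), ← mul_add]
      refine mul_le_mul_of_nonneg_left (hFS.trans (le_of_eq ?_)) (by positivity)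
      congr 1
      · exact Finset.sum_congr rfl fun e he => by simp [he]
      · exact Finset.sum_congr rfl fun e he => by simp [(Finset.mem_sdiff.1 he).2])
  have h1 : ∏ e ∈ E, ((p : ℝ) * Real.exp (θ / (2 * D) * ((1 - (p + θ / 2)) * d e)) +
      (1 - p) * Real.exp (θ / (2 * D) * ((0 - (p + θ / 2)) * d e))) ≤ 1 :=
    Finset.prod_le_one
      (fun e _ => add_nonneg (mul_nonneg p.2.1 (Real.exp_pos _).le)
        (mul_nonneg (by linarith [p.2.2]) (Real.exp_pos _).le))
      (fun e _ => bernoulli_exp_moment_le_one p.2.1 p.2.2 hθ0 hθ1 hD (hd0 e) (hdD e))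
  rw [Real.exp_neg, ← one_div, le_div_iff₀ (Real.exp_pos _), mul_comm]
  exact key.trans h1

end SetBernoulli

/-! ### Sums of squared edge lengths -/

section EdgeSums

/-- The squared length of an edge under a map of the vertices to a normed space. -/
def edgeSq {V H : Type*} [NormedAddCommGroup H] (f : V → H) : Sym2 V → ℝ :=
  Sym2.lift ⟨fun u v => ‖f u - f v‖ ^ 2, fun u v => by simp only [norm_sub_rev]⟩

theorem edgeSq_mk {V H : Type*} [NormedAddCommGroup H] (f : V → H) (u v : V) :
    edgeSq f s(u, v) = ‖f u - f v‖ ^ 2 := rfl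

theorem edgeSq_nonneg {V H : Type*} [NormedAddCommGroup H] (f : V → H) (e : Sym2 V) :
    0 ≤ edgeSq f e := by
  induction e with | _ u v => rw [edgeSq_mk]; positivity

theorem edgeSq_le {V H : Type*} [NormedAddCommGroup H] (f : V → H) {R : ℝ}
    (hf : ∀ u, ‖f u‖ ≤ R) (e : Sym2 V) : edgeSq f e ≤ 4 * R ^ 2 := by
  induction e with
  | _ u v =>
    rw [edgeSq_mk]
    have h := norm_sub_le (f u) (f v)
    nlinarith [hf u, hf v, norm_nonneg (f u - f v)]

open Classical in
theorem SimpleGraph.sum_sum_adj_eq_two_mul {V : Type*} [Fintype V] (G : SimpleGraph V)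
    (f : Sym2 V → ℝ) :
    (∑ u, ∑ v, if G.Adj u v then f s(u, v) else 0) = 2 * ∑ e ∈ G.edgeSet.toFinset, f e := by
  rw [← Finset.sum_product', Finset.univ_product_univ, ← Finset.sum_filter,
    ← Finset.sum_fiberwise_of_maps_to (s := Finset.univ.filter fun p : V × V => G.Adj p.1 p.2)
      (t := G.edgeSet.toFinset) (g := fun p : V × V => s(p.1, p.2)) (by simp), Finset.mul_sum]
  refine Finset.sum_congr rfl fun e he => ?_
  induction e with
  | _ u v =>
    have huv : G.Adj u v := by simpa using he
    have hfib : {p ∈ Finset.univ.filter fun p : V × V => G.Adj p.1 p.2 | s(p.1, p.2) = s(u, v)} =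
        {(u, v), (v, u)} := by
      ext ⟨a, b⟩
      simp only [Finset.mem_filter, Finset.mem_univ, true_and, Sym2.eq_iff, Finset.mem_insert,
        Finset.mem_singleton, Prod.mk.injEq]
      constructor
      · exact fun h => h.2
      · rintro (⟨rfl, rfl⟩ | ⟨rfl, rfl⟩)
        · exact ⟨huv, Or.inl ⟨rfl, rfl⟩⟩
        · exact ⟨huv.symm, Or.inr ⟨rfl, rfl⟩⟩
    rw [hfib, Finset.sum_pair (by simp [huv.ne])]
    rw [Sym2.eq_swap (a := v)]
    ring

end EdgeSums

/-! ### Collapsing the zero layer of an SDP solution -/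

namespace UniqueGame

variable {V : Type*} {G : SimpleGraph V} {k : ℕ}
  {E : Type*} [NormedAddCommGroup E]

/-- The system of vectors in which all vectors of the zero layer are replaced by one unit vector
orthogonal to all others. -/
noncomputable def collapseZero [NeZero k] (x : V → Fin k → E) (u : V) (i : Fin k) :
    WithLp 2 (E × ℝ) :=
  if i = 0 then WithLp.toLp 2 (0, 1) else WithLp.toLp 2 (x u i, 0)

section collapseZero

variable [NeZero k] (x : V → Fin k → E)

theorem norm_sub_collapseZero_zero_zero (u v : V) :
    ‖collapseZero x u 0 - collapseZero x v 0‖ ^ 2 = 0 := by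
  simp [collapseZero]

theorem norm_sub_collapseZero_of_ne (u v : V) {i j : Fin k} (hi : i ≠ 0) (hj : j ≠ 0) :
    ‖collapseZero x u i - collapseZero x v j‖ ^ 2 = ‖x u i - x v j‖ ^ 2 := by
  simp [collapseZero, hi, hj, WithLp.prod_norm_sq_eq_of_L2]

theorem norm_sub_collapseZero_left (hx : ∀ u i, ‖x u i‖ = 1) (u v : V) {j : Fin k} (hj : j ≠ 0) :
    ‖collapseZero x u 0 - collapseZero x v j‖ ^ 2 = 2 := by
  simp [collapseZero, hj, WithLp.prod_norm_sq_eq_of_L2, hx]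
  norm_num

theorem norm_sub_collapseZero_right (hx : ∀ u i, ‖x u i‖ = 1) (u v : V) {i : Fin k} (hi : i ≠ 0) :
    ‖collapseZero x u i - collapseZero x v 0‖ ^ 2 = 2 := by
  rw [norm_sub_rev, norm_sub_collapseZero_left x hx v u hi]

/-- The change of the cost of an edge whose constraint preserves the zero layer. -/
theorem sum_collapseZero_of_apply_zero (u v : V) (π : Equiv.Perm (Fin k)) (hπ : π 0 = 0) :
    ∑ i, ‖collapseZero x u i - collapseZero x v (π i)‖ ^ 2 / 2 ≤
      ∑ i, ‖x u i - x v (π i)‖ ^ 2 / 2 - ‖x u 0 - x v 0‖ ^ 2 / 2 := by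
  rw [← Finset.add_sum_erase _ _ (Finset.mem_univ (0 : Fin k)),
    ← Finset.add_sum_erase (a := (0 : Fin k)) Finset.univ
      (fun i => ‖x u i - x v (π i)‖ ^ 2 / 2) (Finset.mem_univ _),
    hπ, norm_sub_collapseZero_zero_zero]
  refine le_of_eq ?_
  rw [add_sub_cancel_left, zero_div, zero_add]
  refine Finset.sum_congr rfl fun i hi => ?_
  have hi0 := Finset.ne_of_mem_erase hi
  rw [norm_sub_collapseZero_of_ne x u v hi0 fun h => hi0 (π.injective (h.trans hπ.symm))]

end collapseZero

open Classical in
/-- If few edges of the zero layer are super short, its total squared length is large. -/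
theorem mul_card_sub_le_sum_edgeSq [Fintype V] [NeZero k] {I J : UniqueGame G k}
    {F : Set (Sym2 V)} (hI : I.SatisfiedBy fun _ => 0) (hJ : I.IsCorruption F J)
    (x : V → Fin k → E) {cstar η t : ℝ} (ht0 : 0 ≤ t)
    (ht : t ≤ cstar * η ^ 2 / Real.logb 2 k) :
    t * ((G.edgeSet.toFinset.card : ℝ) - (J.superShortZero cstar η x).ncard -
      ∑ e ∈ G.edgeSet.toFinset, F.indicator (fun _ => (1 : ℝ)) e) ≤
        ∑ e ∈ G.edgeSet.toFinset, edgeSq (fun u => x u 0) e := by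
  set A := G.edgeSet.toFinset.filter fun e => e ∉ F ∧ edgeSq (fun u => x u 0) e ≤ t with hA
  have hcard : A.card ≤ (J.superShortZero cstar η x).ncard := by
    have hinj : Function.Injective (Sym2.map fun u : V => (u, (0 : Fin k))) :=
      Sym2.map.injective fun u v h => (Prod.mk.inj h).1
    rw [← Finset.card_image_of_injective A hinj, ← Set.ncard_coe_finset]
    refine Set.ncard_le_ncard ?_ (Set.toFinite _)
    intro e he
    obtain ⟨e, heA, rfl⟩ := Finset.mem_image.1 (Finset.mem_coe.1 he)
    induction e with
    | _ u v =>
      obtain ⟨h1, hF, hshort⟩ := Finset.mem_filter.1 heA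
      have huv : G.Adj u v := by simpa using h1
      refine ⟨⟨(u, 0), (v, 0), rfl, ⟨huv, ?_⟩, hshort.trans ht⟩, u, v, huv, rfl⟩
      rw [hJ u v huv hF]
      exact hI u v huv
  -- The left side vanishes unless the edge is both uncorrupted and longer than `t`.
  have hpt : ∀ e ∈ G.edgeSet.toFinset,
      t * (1 - (if e ∉ F ∧ edgeSq (fun u => x u 0) e ≤ t then 1 else 0) -
        F.indicator (fun _ => (1 : ℝ)) e) ≤ edgeSq (fun u => x u 0) e := by
    intro e _
    have h0 := edgeSq_nonneg (fun u => x u 0) e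
    by_cases hF : e ∈ F
    · simpa [hF] using h0
    · by_cases hs : edgeSq (fun u => x u 0) e ≤ t
      · simpa [hF, hs] using h0
      · simpa [hF, hs] using (not_le.1 hs).le
  have hsum := Finset.sum_le_sum hpt
  rw [← Finset.mul_sum, Finset.sum_sub_distrib, Finset.sum_sub_distrib, Finset.sum_boole, ← hA,
    Finset.sum_const, nsmul_eq_mul, mul_one] at hsum
  refine le_trans (mul_le_mul_of_nonneg_left ?_ ht0) hsum
  have : (A.card : ℝ) ≤ (J.superShortZero cstar η x).ncard := by exact_mod_cast hcard
  linarith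

section InnerProduct

variable [InnerProductSpace ℝ E]

theorem CrudeFeasible.map_isometry {E' : Type*} [NormedAddCommGroup E'] [InnerProductSpace ℝ E']
    {I : UniqueGame G k} {x : V → Fin k → E} (hx : I.CrudeFeasible x) (L : E ≃ₗᵢ[ℝ] E') :
    I.CrudeFeasible fun u i => L (x u i) where
  norm_eq_one u i := by rw [L.norm_map, hx.norm_eq_one]
  orthogonal u i i' h := by rw [L.inner_map_map, hx.orthogonal u i i' h]
  triangle u v h i i' j hi := by
    rw [← map_sub, ← map_sub, L.norm_map, L.norm_map]
    exact hx.triangle u v h i i' j hi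

theorem crudeValue_map_isometry [Fintype V] {E' : Type*} [NormedAddCommGroup E']
    [InnerProductSpace ℝ E'] (I : UniqueGame G k) (x : V → Fin k → E) (L : E ≃ₗᵢ[ℝ] E') :
    I.crudeValue (fun u i => L (x u i)) = I.crudeValue x := by
  simp only [crudeValue, ← map_sub, L.norm_map]

/-- Choosing an orthonormal basis moves the competitor into coordinates; this is needed because the
collapsed system lives in a product with ℝ. -/
theorem CrudeOptimal.le_crudeValue [Fintype V] [FiniteDimensional ℝ E] {I : UniqueGame G k}
    {d : ℕ} {x : V → Fin k → EuclideanSpace ℝ (Fin d)} (hx : I.CrudeOptimal x)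
    {y : V → Fin k → E} (hy : I.CrudeFeasible y) : I.crudeValue x ≤ I.crudeValue y := by
  have h := hx.2 _ _ (hy.map_isometry (stdOrthonormalBasis ℝ E).repr)
  rwa [crudeValue_map_isometry] at h

variable [NeZero k] {x : V → Fin k → E}

/-- The new vector is at squared distance 2 from every vector of a nonzero label, so a triangle
constraint involving label 0 holds through a single term. -/
theorem CrudeFeasible.collapseZero {I : UniqueGame G k} (hx : I.CrudeFeasible x) :
    I.CrudeFeasible (collapseZero x) where
  norm_eq_one u i := by
    rw [← sq_eq_sq₀ (norm_nonneg _) zero_le_one, WithLp.prod_norm_sq_eq_of_L2]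
    by_cases hi : i = 0 <;> simp [UniqueGame.collapseZero, hi, hx.norm_eq_one]
  orthogonal u i i' h := by
    rw [WithLp.prod_inner_apply]
    by_cases hi : i = 0
    · have hi' : i' ≠ 0 := fun h' => h (hi.trans h'.symm)
      simp [UniqueGame.collapseZero, hi, hi']
    · by_cases hi' : i' = 0
      · simp [UniqueGame.collapseZero, hi, hi']
      · simp [UniqueGame.collapseZero, hi, hi', hx.orthogonal u i i' h]
  triangle u v h i i' j hne := by
    have hL := norm_sub_collapseZero_left x hx.norm_eq_one u v (j := j)
    have h1 := sq_nonneg ‖UniqueGame.collapseZero x u i - UniqueGame.collapseZero x v j‖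
    have h2 := sq_nonneg ‖UniqueGame.collapseZero x u i' - UniqueGame.collapseZero x v j‖
    by_cases hj : j = 0
    · subst hj
      by_cases hi : i = 0
      · have := norm_sub_collapseZero_right x hx.norm_eq_one u v (i := i')
          (fun h' => hne (hi.trans h'.symm))
        linarith
      · have := norm_sub_collapseZero_right x hx.norm_eq_one u v hi
        linarith
    · by_cases hi : i = 0
      · subst hi
        linarith [hL hj]
      · by_cases hi' : i' = 0
        · subst hi'
          linarith [hL hj]
        · rw [norm_sub_collapseZero_of_ne x u v hi hj, norm_sub_collapseZero_of_ne x u v hi' hj]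
          exact hx.triangle u v h i i' j hne

/-- The change of the cost of an edge with an arbitrary constraint. -/
theorem CrudeFeasible.sum_collapseZero_le {I : UniqueGame G k} (hx : I.CrudeFeasible x) {u v : V}
    (huv : G.Adj u v) (π : Equiv.Perm (Fin k)) :
    ∑ i, ‖UniqueGame.collapseZero x u i - UniqueGame.collapseZero x v (π i)‖ ^ 2 / 2 ≤
      ∑ i, ‖x u i - x v (π i)‖ ^ 2 / 2 + ‖x u 0 - x v 0‖ ^ 2 := by
  by_cases hπ : π 0 = 0
  · refine (sum_collapseZero_of_apply_zero x u v π hπ).trans ?_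
    nlinarith [sq_nonneg ‖x u 0 - x v 0‖]
  · set d := ‖x u 0 - x v 0‖ ^ 2 with hd
    have hd0 : 0 ≤ d := sq_nonneg _
    -- Only the two label edges meeting (u,0) or (v,0) change. Each now costs 1, and a triangle
    -- constraint bounds 1 by the old cost plus d/2.
    have hpt : ∀ i, ‖UniqueGame.collapseZero x u i - UniqueGame.collapseZero x v (π i)‖ ^ 2 / 2 ≤
        ‖x u i - x v (π i)‖ ^ 2 / 2 +
          ((if i = 0 then d / 2 else 0) + if i = π.symm 0 then d / 2 else 0) := by
      intro i
      by_cases hi : i = 0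
      · subst hi
        have ht := hx.triangle v u huv.symm (π 0) 0 0 hπ
        rw [norm_sub_rev, norm_sub_rev (x v 0), ← hd] at ht
        rw [norm_sub_collapseZero_left x hx.norm_eq_one u v hπ, if_pos rfl]
        split_ifs <;> linarith
      · by_cases hi' : π i = 0
        · have ht := hx.triangle u v huv i 0 0 hi
          rw [← hd] at ht
          rw [hi', norm_sub_collapseZero_right x hx.norm_eq_one u v hi, if_neg hi,
            if_pos (by rw [← hi', Equiv.symm_apply_apply])]
          linarith
        · rw [norm_sub_collapseZero_of_ne x u v hi hi']
          split_ifs <;> linarith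
    refine (Finset.sum_le_sum fun i _ => hpt i).trans (le_of_eq ?_)
    rw [Finset.sum_add_distrib, Finset.sum_add_distrib]
    simp

open Classical in
/-- In an optimal solution the corrupted edges carry at least one third of the total squared length
of the zero layer. -/
theorem CrudeOptimal.sum_edgeSq_nonneg [Fintype V] {I J : UniqueGame G k} {F : Set (Sym2 V)}
    (hI : I.SatisfiedBy fun _ => 0) (hJ : I.IsCorruption F J) {d : ℕ}
    {x : V → Fin k → EuclideanSpace ℝ (Fin d)} (hx : J.CrudeOptimal x) :
    0 ≤ ∑ e ∈ G.edgeSet.toFinset,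
      (F.indicator (fun _ => (1 : ℝ)) e - 1 / 3) * edgeSq (fun u => x u 0) e := by
  have hle := hx.le_crudeValue hx.1.collapseZero
  -- The weight (3/2)(1_F - 1/3) equals 1 on corrupted edges and -1/2 on the others.
  have hub : J.crudeValue (UniqueGame.collapseZero x) ≤ J.crudeValue x +
      (1 / 2) * ∑ u, ∑ v, if G.Adj u v then
        (3 / 2) * ((F.indicator (fun _ => (1 : ℝ)) s(u, v) - 1 / 3) *
          edgeSq (fun u => x u 0) s(u, v)) else 0 := by
    rw [crudeValue, crudeValue, ← mul_add, ← Finset.sum_add_distrib]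
    refine mul_le_mul_of_nonneg_left (Finset.sum_le_sum fun u _ => ?_) (by norm_num)
    rw [← Finset.sum_add_distrib]
    refine Finset.sum_le_sum fun v _ => ?_
    split_ifs with huv
    · rw [edgeSq_mk]
      by_cases hF : s(u, v) ∈ F
      · rw [Set.indicator_of_mem hF]
        refine (hx.1.sum_collapseZero_le huv (J.perm u v)).trans (le_of_eq ?_)
        ring
      · rw [Set.indicator_of_notMem hF]
        refine (sum_collapseZero_of_apply_zero x u v (J.perm u v) ?_).trans (le_of_eq ?_)
        · rw [hJ u v huv hF]
          exact hI u v huv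
        · ring
    · simp
  rw [G.sum_sum_adj_eq_two_mul fun e => (3 / 2) * ((F.indicator (fun _ => (1 : ℝ)) e - 1 / 3) *
          edgeSq (fun u => x u 0) e), ← Finset.mul_sum] at hub
  linarith

end InnerProduct

end UniqueGame

/-! ### Moments of random signs -/

section RandomSigns

/-- Random signs, as a finite family of vectors: the second moment of a linear form is its squared
norm, and the fourth moment is at most three times the square of that. -/
theorem exists_signs (d : ℕ) : ∃ (N : ℕ) (g : Fin N → Fin d → ℝ), 0 < N ∧
    ∀ u : Fin d → ℝ, ∑ i, (∑ j, g i j * u j) ^ 2 = N * ∑ j, u j ^ 2 ∧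
      ∑ i, (∑ j, g i j * u j) ^ 4 ≤ 3 * N * (∑ j, u j ^ 2) ^ 2 := by
  induction d with
  | zero => exact ⟨1, fun _ _ => 0, one_pos, fun u => by simp⟩
  | succ d ih =>
    obtain ⟨N, g, hN, hg⟩ := ih
    -- Each sign vector is extended by both signs; odd powers of the new coordinate cancel between
    -- the two copies.
    refine ⟨N + N, Fin.append (fun i => Fin.cons 1 (g i)) (fun i => Fin.cons (-1) (g i)),
      by omega, fun u => ?_⟩
    obtain ⟨h2, h4⟩ := hg (Fin.tail u)
    simp only [Fin.tail] at h2 h4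
    rw [Fin.sum_univ_add (a := N) (b := N), Fin.sum_univ_add (a := N) (b := N)]
    simp only [Fin.append_left, Fin.append_right, Fin.sum_univ_succ, Fin.cons_zero, Fin.cons_succ]
    rw [← Finset.sum_add_distrib, ← Finset.sum_add_distrib]
    set X : Fin N → ℝ := fun i => ∑ j, g i j * u j.succ
    set s := ∑ j : Fin d, u j.succ ^ 2
    replace h2 : ∑ i, X i ^ 2 = N * s := h2
    replace h4 : ∑ i, X i ^ 4 ≤ 3 * N * s ^ 2 := h4
    have e2 : ∀ i, (1 * u 0 + X i) ^ 2 + (-1 * u 0 + X i) ^ 2 = 2 * u 0 ^ 2 + 2 * X i ^ 2 :=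
      fun i => by ring
    have e4 : ∀ i, (1 * u 0 + X i) ^ 4 + (-1 * u 0 + X i) ^ 4 =
        2 * u 0 ^ 4 + 12 * u 0 ^ 2 * X i ^ 2 + 2 * X i ^ 4 := fun i => by ring
    constructor
    · rw [Finset.sum_congr rfl fun i _ => e2 i, Finset.sum_add_distrib,
        ← Finset.mul_sum (f := fun i => X i ^ 2), h2]
      simp only [Finset.sum_const, Finset.card_univ, Fintype.card_fin, nsmul_eq_mul]
      push_cast
      ring
    · rw [Finset.sum_congr rfl fun i _ => e4 i, Finset.sum_add_distrib, Finset.sum_add_distrib,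
        ← Finset.mul_sum (f := fun i => X i ^ 2), ← Finset.mul_sum (f := fun i => X i ^ 4), h2]
      simp only [Finset.sum_const, Finset.card_univ, Fintype.card_fin, nsmul_eq_mul]
      push_cast
      -- The target exceeds the bound obtained so far by exactly four times this quantity.
      have h0 : (0 : ℝ) ≤ N * u 0 ^ 4 := by positivity
      nlinarith

end RandomSigns

/-! ### Projection to a line, truncation and rounding -/

section Truncation

/-- Truncation of a real number to `[-M, M]`. -/
noncomputable def truncate (M a : ℝ) : ℝ := max (-M) (min a M)

theorem abs_truncate_le {M : ℝ} (hM : 0 ≤ M) (a : ℝ) : |truncate M a| ≤ M :=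
  abs_le.2 ⟨le_max_left _ _, max_le (by linarith) (min_le_right _ _)⟩

theorem truncate_of_abs_le {M a : ℝ} (h : |a| ≤ M) : truncate M a = a := by
  rw [truncate, min_eq_left (abs_le.1 h).2, max_eq_right (abs_le.1 h).1]

theorem abs_truncate_sub_truncate_le (M a b : ℝ) : |truncate M a - truncate M b| ≤ |a - b| := by
  refine (abs_max_sub_max_le_max _ _ _ _).trans (max_le (by simp) ?_)
  exact (abs_min_sub_min_le_max _ _ _ _).trans (max_le le_rfl (by simp))

/-- There is an error only if |a| or |b| exceeds M, and then (a² + b²)/M² ≥ 1. Keeping the factor (a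
- b)² makes the error relative to the edge length. -/
theorem abs_sq_sub_truncate_sq_le {M : ℝ} (hM : 0 < M) (a b : ℝ) :
    |(a - b) ^ 2 - (truncate M a - truncate M b) ^ 2| ≤ (a - b) ^ 2 * (a ^ 2 + b ^ 2) / M ^ 2 := by
  have h1 : (truncate M a - truncate M b) ^ 2 ≤ (a - b) ^ 2 :=
    sq_le_sq.2 (abs_truncate_sub_truncate_le M a b)
  have h2 := sq_nonneg (truncate M a - truncate M b)
  rw [abs_of_nonneg (by linarith)]
  by_cases h : |a| ≤ M ∧ |b| ≤ M
  · rw [truncate_of_abs_le h.1, truncate_of_abs_le h.2, sub_self]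
    positivity
  · have h3 : M ^ 2 ≤ a ^ 2 + b ^ 2 := by
      rcases not_and_or.1 h with h | h
      · have := sq_le_sq.2 (show |M| ≤ |a| by rw [abs_of_pos hM]; linarith)
        nlinarith [sq_nonneg b]
      · have := sq_le_sq.2 (show |M| ≤ |b| by rw [abs_of_pos hM]; linarith)
        nlinarith [sq_nonneg a]
    rw [le_div_iff₀ (by positivity)]
    nlinarith [mul_le_mul_of_nonneg_left h3 (sq_nonneg (a - b)), sq_nonneg M]

/-- Cauchy–Schwarz reduces mixed moments to fourth moments, so no independence of the two linear
forms is needed. -/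
theorem sum_sq_mul_sq_le {ι : Type*} [Fintype ι] {N A B : ℝ} (hA : 0 ≤ A) (hB : 0 ≤ B)
    (hN : 0 ≤ N) (X Y : ι → ℝ) (hX : ∑ i, X i ^ 4 ≤ 3 * N * A ^ 2)
    (hY : ∑ i, Y i ^ 4 ≤ 3 * N * B ^ 2) : ∑ i, X i ^ 2 * Y i ^ 2 ≤ 3 * N * (A * B) := by
  refine abs_le_of_sq_le_sq' ?_ (by positivity) |>.2
  refine (Finset.sum_mul_sq_le_sq_mul_sq _ _ _).trans ?_
  have e : (3 * N * (A * B)) ^ 2 = (3 * N * A ^ 2) * (3 * N * B ^ 2) := by ring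
  rw [e]
  simp only [← pow_mul]
  exact mul_le_mul hX hY (Finset.sum_nonneg fun i _ => (even_two_mul 2).pow_nonneg _) (by positivity)

/-- Projection to the line: a signed sum of squared lengths of unit vectors is, up to a small
relative error, at most that of a bounded system of reals. -/
theorem exists_real_sum_edgeSq_ge {V : Type*} {d : ℕ} (x : V → EuclideanSpace ℝ (Fin d))
    (hx : ∀ u, ‖x u‖ = 1) (E : Finset (Sym2 V)) (b : Sym2 V → ℝ) (hb : ∀ e ∈ E, |b e| ≤ 1) {M : ℝ}
    (hM : 0 < M) : ∃ g : V → ℝ, (∀ u, |g u| ≤ M) ∧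
      ∑ e ∈ E, b e * edgeSq x e - 6 / M ^ 2 * ∑ e ∈ E, edgeSq x e ≤
        ∑ e ∈ E, b e * edgeSq g e := by
  obtain ⟨N, g, hN, hg⟩ := exists_signs d
  have hN' : (0 : ℝ) < N := by exact_mod_cast hN
  set X : Fin N → V → ℝ := fun i u => ∑ j, g i j * x u j with hX
  have hsub : ∀ i u v, X i u - X i v = ∑ j, g i j * (x u - x v) j := by
    intro i u v
    simp only [hX, ← Finset.sum_sub_distrib, PiLp.sub_apply, mul_sub]
  -- The terms with a² and b² in the truncation error each average to at most 3‖x u - x v‖²/M²,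
  -- whence the 6.
  have hedge : ∀ e, N * edgeSq x e - ∑ i, edgeSq (fun u => truncate M (X i u)) e ≤
        N * (6 / M ^ 2 * edgeSq x e) ∧
      -(N * (6 / M ^ 2 * edgeSq x e)) ≤
        N * edgeSq x e - ∑ i, edgeSq (fun u => truncate M (X i u)) e := by
    intro e
    rw [and_comm, ← abs_le]
    induction e with
    | _ u v =>
      simp only [edgeSq_mk, Real.norm_eq_abs, sq_abs]
      have hn : ∀ w : EuclideanSpace ℝ (Fin d), ∑ j, w j ^ 2 = ‖w‖ ^ 2 := fun w => by
        rw [EuclideanSpace.real_norm_sq_eq]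
      have h2 : ∑ i, (X i u - X i v) ^ 2 = N * ‖x u - x v‖ ^ 2 := by
        simp only [hsub]
        rw [(hg _).1, hn]
      have h4 : ∑ i, (X i u - X i v) ^ 4 ≤ 3 * N * (‖x u - x v‖ ^ 2) ^ 2 := by
        simp only [hsub]
        rw [← hn]
        exact (hg _).2
      have h4' : ∀ w, ∑ i, X i w ^ 4 ≤ 3 * N * (1 : ℝ) ^ 2 := by
        intro w
        refine ((hg (x w)).2).trans (le_of_eq ?_)
        rw [hn, hx]
        norm_num
      have hu := sum_sq_mul_sq_le (sq_nonneg _) zero_le_one hN'.le _ _ h4 (h4' u)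
      have hv := sum_sq_mul_sq_le (sq_nonneg _) zero_le_one hN'.le _ _ h4 (h4' v)
      rw [← h2, ← Finset.sum_sub_distrib]
      refine (Finset.abs_sum_le_sum_abs _ _).trans
        ((Finset.sum_le_sum fun i _ => abs_sq_sub_truncate_sq_le hM _ _).trans ?_)
      rw [← Finset.sum_div, div_le_iff₀ (by positivity)]
      simp only [mul_add]
      rw [Finset.sum_add_distrib]
      have e1 : (N : ℝ) * (6 / M ^ 2 * ‖x u - x v‖ ^ 2) * M ^ 2 = 6 * N * ‖x u - x v‖ ^ 2 := by
        field_simp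
      rw [e1]
      linarith
  have htot : N * (∑ e ∈ E, b e * edgeSq x e - 6 / M ^ 2 * ∑ e ∈ E, edgeSq x e) ≤
      ∑ i, ∑ e ∈ E, b e * edgeSq (fun u => truncate M (X i u)) e := by
    rw [Finset.sum_comm, Finset.mul_sum, ← Finset.sum_sub_distrib, Finset.mul_sum]
    refine Finset.sum_le_sum fun e he => ?_
    rw [← Finset.mul_sum]
    have hbe := abs_le.1 (hb e he)
    obtain ⟨h1, h2⟩ := hedge e
    have hP : 0 ≤ N * (6 / M ^ 2 * edgeSq x e) :=
      mul_nonneg hN'.le (mul_nonneg (by positivity) (edgeSq_nonneg x e))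
    have habs : |b e * (N * edgeSq x e - ∑ i, edgeSq (fun u => truncate M (X i u)) e)| ≤
        1 * (N * (6 / M ^ 2 * edgeSq x e)) := by
      rw [abs_mul]
      exact mul_le_mul (hb e he) (abs_le.2 ⟨h2, h1⟩) (abs_nonneg _) zero_le_one
    have := (abs_le.1 habs).2
    linarith
  have hne : (Finset.univ : Finset (Fin N)).Nonempty := ⟨⟨0, hN⟩, Finset.mem_univ _⟩
  obtain ⟨i, -, hi⟩ := Finset.exists_le_of_sum_le hne
    (f := fun _ : Fin N => ∑ e ∈ E, b e * edgeSq x e - 6 / M ^ 2 * ∑ e ∈ E, edgeSq x e)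
    (g := fun i => ∑ e ∈ E, b e * edgeSq (fun u => truncate M (X i u)) e) (by
      rwa [Finset.sum_const, Finset.card_univ, Fintype.card_fin, nsmul_eq_mul])
  exact ⟨fun u => truncate M (X i u), fun u => abs_truncate_le hM.le _, hi⟩

/-- Rounding a bounded system of reals to a grid of mesh `r`. -/
theorem exists_grid_sum_edgeSq_ge {V : Type*} (g : V → ℝ) {M r : ℝ} (hr : 0 < r) (hrM : r ≤ M)
    (hg : ∀ u, |g u| ≤ M) (E : Finset (Sym2 V)) (b : Sym2 V → ℝ) (hb : ∀ e ∈ E, |b e| ≤ 1) :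
    ∃ h : V → Fin (2 * ⌈M / r⌉₊ + 1),
      ∑ e ∈ E, b e * edgeSq g e - 6 * M * r * E.card ≤
        ∑ e ∈ E, b e * edgeSq (fun u => r * ((h u : ℝ) - ⌈M / r⌉₊)) e := by
  set m := ⌈M / r⌉₊ with hm
  have hmM : M / r ≤ m := Nat.le_ceil _
  have hfl : ∀ u, (0 : ℤ) ≤ ⌊g u / r⌋ + m ∧ ⌊g u / r⌋ + m < ((2 * m + 1 : ℕ) : ℤ) := by
    intro u
    obtain ⟨h1, h2⟩ := abs_le.1 (hg u)
    have h3 : ((-(m : ℤ) : ℤ) : ℝ) ≤ g u / r := by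
      push_cast
      rw [neg_le, ← neg_div]
      exact (div_le_div_of_nonneg_right (by linarith) hr.le).trans hmM
    have h4 : g u / r ≤ m := (div_le_div_of_nonneg_right h2 hr.le).trans hmM
    have h5 := Int.le_floor.2 h3
    have h6 : ⌊g u / r⌋ ≤ (m : ℤ) := by
      have := (Int.floor_le (g u / r)).trans h4
      exact_mod_cast this
    push_cast
    omega
  refine ⟨fun u => ⟨(⌊g u / r⌋ + m).toNat, by have := hfl u; omega⟩, ?_⟩
  have hval : ∀ u, r * ((((⌊g u / r⌋ + m).toNat : ℕ) : ℝ) - m) = r * ⌊g u / r⌋ := by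
    intro u
    have h1 : (((⌊g u / r⌋ + m).toNat : ℤ) : ℝ) = ((⌊g u / r⌋ + m : ℤ) : ℝ) := by
      rw [Int.toNat_of_nonneg (hfl u).1]
    have h2 : (((⌊g u / r⌋ + m).toNat : ℕ) : ℝ) = ⌊g u / r⌋ + m := by exact_mod_cast h1
    rw [h2]
    ring
  simp only [hval]
  rw [mul_comm (6 * M * r), ← nsmul_eq_mul, ← Finset.sum_const, ← Finset.sum_sub_distrib]
  refine Finset.sum_le_sum fun e he => ?_
  -- Factor as a difference of squares: both differences are at most 3M in absolute value, as r ≤ M,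
  -- and they differ by at most r.
  have hround : |edgeSq g e - edgeSq (fun u => r * (⌊g u / r⌋ : ℝ)) e| ≤ 6 * M * r := by
    induction e with
    | _ u v =>
      simp only [edgeSq_mk, Real.norm_eq_abs, sq_abs]
      have hlo : ∀ w, r * (⌊g w / r⌋ : ℝ) ≤ g w := fun w => by
        have := mul_le_mul_of_nonneg_left (Int.floor_le (g w / r)) hr.le
        rwa [mul_div_cancel₀ _ hr.ne'] at this
      have hhi : ∀ w, g w ≤ r * (⌊g w / r⌋ : ℝ) + r := fun w => by
        have := mul_le_mul_of_nonneg_left (Int.lt_floor_add_one (g w / r)).le hr.le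
        rw [mul_div_cancel₀ _ hr.ne'] at this
        linarith
      obtain ⟨hu1, hu2⟩ := abs_le.1 (hg u)
      obtain ⟨hv1, hv2⟩ := abs_le.1 (hg v)
      have hu3 := hlo u
      have hu4 := hhi u
      have hv3 := hlo v
      have hv4 := hhi v
      rw [sq_sub_sq, abs_mul, show 6 * M * r = (6 * M) * r by ring]
      refine mul_le_mul (abs_le.2 ⟨?_, ?_⟩) (abs_le.2 ⟨?_, ?_⟩) (abs_nonneg _) ?_ <;> linarith
  have h1 : |b e * (edgeSq g e - edgeSq (fun u => r * (⌊g u / r⌋ : ℝ)) e)| ≤ 1 * (6 * M * r) := by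
    rw [abs_mul]
    exact mul_le_mul (hb e he) hround (abs_nonneg _) zero_le_one
  have := (abs_le.1 h1).2
  linarith

end Truncation

/-! ### Union bound over the grid -/

section Net

open ProbabilityTheory MeasureTheory

/-- A union bound over all systems of reals on a grid. -/
theorem setBernoulli_real_exists_edgeSq_le {V : Type*} [Fintype V] (E : Finset (Sym2 V))
    (p : unitInterval) {θ r M : ℝ} (hθ0 : 0 < θ) (hθ1 : θ ≤ 1) (hr : 0 < r) (hM : 0 < M) (m : ℕ)
    (hm : r * m ≤ 2 * M) (t : ℝ) :
    (setBernoulli (E : Set (Sym2 V)) p).real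
      {F | ∃ h : V → Fin (2 * m + 1),
        t ≤ ∑ e ∈ E, (F.indicator (fun _ => (1 : ℝ)) e - (p + θ / 2)) *
          edgeSq (fun u => r * ((h u : ℝ) - m)) e} ≤
      (2 * m + 1 : ℝ) ^ Fintype.card V * Real.exp (-(θ / (2 * (4 * (2 * M) ^ 2)) * t)) := by
  classical
  rw [Set.ofPred_exists]
  refine (measureReal_iUnion_fintype_le _).trans ?_
  refine (Finset.sum_le_sum fun h _ => setBernoulli_real_excess_le E p hθ0 hθ1
    (D := 4 * (2 * M) ^ 2) (by positivity) _ (edgeSq_nonneg _) (edgeSq_le _ fun u => ?_) t).trans ?_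
  · have h1 : ((h u : ℕ) : ℝ) ≤ 2 * m := by exact_mod_cast Nat.lt_succ_iff.1 (h u).2
    have h2 : (0 : ℝ) ≤ (h u : ℕ) := Nat.cast_nonneg _
    rw [Real.norm_eq_abs, abs_mul, abs_of_pos hr]
    exact (mul_le_mul_of_nonneg_left (abs_le.2 ⟨by linarith, by linarith⟩) hr.le).trans hm
  · rw [Finset.sum_const, Finset.card_univ, Fintype.card_fun, Fintype.card_fin, nsmul_eq_mul]
    push_cast
    exact le_rfl

/-- A violated inequality between squared lengths of unit vectors is violated on a grid. -/
theorem exists_grid_of_unit_vectors {V : Type*} {d : ℕ} (x : V → EuclideanSpace ℝ (Fin d))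
    (hx : ∀ u, ‖x u‖ = 1) (E : Finset (Sym2 V)) (b : Sym2 V → ℝ) (hb : ∀ e ∈ E, |b e| ≤ 1)
    {θ τ M r : ℝ} (hθ0 : 0 < θ) (hM0 : 0 < M) (hM : M ^ 2 = 24 / θ)
    (hr : 6 * M * r = θ * τ / 8) (hr0 : 0 < r) (hrM : r ≤ M)
    (hb1 : θ / 2 * ∑ e ∈ E, edgeSq x e ≤ ∑ e ∈ E, b e * edgeSq x e)
    (hL : τ * E.card ≤ ∑ e ∈ E, edgeSq x e) :
    ∃ h : V → Fin (2 * ⌈M / r⌉₊ + 1),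
      θ * τ / 8 * E.card ≤ ∑ e ∈ E, b e * edgeSq (fun u => r * ((h u : ℝ) - ⌈M / r⌉₊)) e := by
  obtain ⟨g, hg, h1⟩ := exists_real_sum_edgeSq_ge x hx E b hb hM0
  obtain ⟨h, h2⟩ := exists_grid_sum_edgeSq_ge g hr0 hrM hg E b hb
  refine ⟨h, le_trans ?_ h2⟩
  -- Truncation uses up half of the surplus θ/2. At least (θ/4)τ|E| remains, and rounding costs half
  -- of that.
  have e1 : 6 / M ^ 2 = θ / 4 := by rw [hM]; field_simp; norm_num
  rw [e1] at h1
  rw [hr]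
  have h3 := mul_le_mul_of_nonneg_left hL (show 0 ≤ θ / 4 by positivity)
  linarith

/-- A system of unit vectors violating the deviation inequality is unlikely to exist. -/
theorem exists_unlikely_of_unit_vectors {V : Type*} [Fintype V] (E : Finset (Sym2 V))
    (p : unitInterval) {θ τ : ℝ} (hθ0 : 0 < θ) (hθ1 : θ ≤ 1) (hpθ : (p : ℝ) + θ / 2 ≤ 1) (hτ0 : 0 < τ)
    (hτ1 : τ ≤ 1)
    (hy : ∀ K : ℝ, 0 < K → K ≤ 2307 / (θ ^ 2 * τ) →
      Fintype.card V * (1 + Real.log K) ≤ θ ^ 3 * τ * E.card / 6144) :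
    ∃ B : Set (Set (Sym2 V)),
      (setBernoulli (E : Set (Sym2 V)) p).real B ≤ Real.exp (-(Fintype.card V : ℝ)) ∧
      ∀ F ∉ B, ∀ (d : ℕ) (x : V → EuclideanSpace ℝ (Fin d)), (∀ u, ‖x u‖ = 1) →
        τ * E.card ≤ ∑ e ∈ E, edgeSq x e →
        ∑ e ∈ E, (F.indicator (fun _ => (1 : ℝ)) e - (p + θ / 2)) * edgeSq x e <
          θ / 2 * ∑ e ∈ E, edgeSq x e := by
  have hp0 : (0 : ℝ) ≤ p := p.2.1
  obtain ⟨M, hMdef⟩ : ∃ M : ℝ, M = √(24 / θ) := ⟨_, rfl⟩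
  have hM0 : 0 < M := by rw [hMdef]; positivity
  have hM : M ^ 2 = 24 / θ := by rw [hMdef, Real.sq_sqrt (by positivity)]
  obtain ⟨r, hr⟩ : ∃ r : ℝ, r = θ * τ / (48 * M) := ⟨_, rfl⟩
  have hr0 : 0 < r := by rw [hr]; positivity
  have hθτ : θ * τ ≤ 1 := mul_le_one₀ hθ1 hτ0.le hτ1
  have hM1 : 1 ≤ M ^ 2 := by
    rw [hM, one_le_div hθ0]
    linarith
  have hrM : r ≤ M := by
    rw [hr, div_le_iff₀ (by positivity)]
    nlinarith
  have hMr : M / r = 1152 / (θ ^ 2 * τ) := by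
    have : M / r = 48 * M ^ 2 / (θ * τ) := by rw [hr]; field_simp
    rw [this, hM]
    field_simp
    norm_num
  set m := ⌈M / r⌉₊
  have hm : (m : ℝ) ≤ M / r + 1 := (Nat.ceil_lt_add_one (by positivity)).le
  refine ⟨{F | ∃ h : V → Fin (2 * m + 1),
    θ * τ / 8 * E.card ≤ ∑ e ∈ E, (F.indicator (fun _ => (1 : ℝ)) e - (p + θ / 2)) *
      edgeSq (fun u => r * ((h u : ℝ) - m)) e}, ?_, ?_⟩
  · refine (setBernoulli_real_exists_edgeSq_le E p hθ0 hθ1 hr0 hM0 m ?_ _).trans ?_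
    · have := mul_le_mul_of_nonneg_left hm hr0.le
      rw [mul_add, mul_div_cancel₀ _ hr0.ne'] at this
      linarith
    have hK0 : (0 : ℝ) < 2 * m + 1 := by positivity
    -- Here 2m + 1 ≤ 2M/r + 3, with 2M/r = 2304/(θ²τ) and 3 ≤ 3/(θ²τ).
    have hK : (2 * m + 1 : ℝ) ≤ 2307 / (θ ^ 2 * τ) := by
      have h1 : 1 ≤ 1 / (θ ^ 2 * τ) := by
        rw [one_le_div (by positivity)]
        calc θ ^ 2 * τ ≤ 1 ^ 2 * 1 := by gcongr
          _ = 1 := by norm_num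
      have e1 : 2307 / (θ ^ 2 * τ) = 2 * (1152 / (θ ^ 2 * τ)) + 3 * (1 / (θ ^ 2 * τ)) := by ring
      rw [e1, ← hMr]
      linarith
    have e1 : θ / (2 * (4 * (2 * M) ^ 2)) * (θ * τ / 8 * E.card) =
        θ ^ 3 * τ * E.card / 6144 := by
      rw [show 2 * (4 * (2 * M) ^ 2) = 32 * M ^ 2 by ring, hM]
      field_simp
      ring
    -- The summand 1 next to log K in `hy` leaves the factor exp(-|V|) after the union bound.
    rw [e1, ← Real.exp_log (pow_pos hK0 _), Real.log_pow, ← Real.exp_add, Real.exp_le_exp]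
    linarith [hy _ hK0 hK]
  · intro F hFB d x hx hL
    by_contra hlt
    refine hFB (exists_grid_of_unit_vectors x hx E
      (fun e => F.indicator (fun _ => (1 : ℝ)) e - (p + θ / 2)) (fun e _ => ?_) hθ0 hM0 hM
      (by rw [hr]; field_simp; norm_num) hr0 hrM (not_lt.1 hlt) hL)
    by_cases he : e ∈ F
    · rw [Set.indicator_of_mem he]
      exact abs_le.2 ⟨by linarith, by linarith⟩
    · rw [Set.indicator_of_notMem he]
      exact abs_le.2 ⟨by linarith, by linarith⟩
end Net

/-! ### Numerical estimates for the exponent and the edge count -/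

section Estimates

/-- K is at most a constant times θ⁻² c1⁻¹ c⁻³ log k. The logarithms of θ⁻² and 2/c1 are bounded
linearly, and c⁻³ log k contributes 3Λ. The lower bound κ on Λ lets Λ²/κ² absorb both 1 and Λ, and
2312 = 2307 + 2 + 3. -/
theorem one_add_log_grid_le {c1 κ θ τ η g lk Λ c : ℝ} (hc1 : 0 < c1) (hκ0 : 0 < κ) (hκ1 : κ ≤ 1) (hθ0 : 0 < θ) (hθ1 : θ ≤ 1) (hc0 : 0 < c) (hη : c < η)
    (hη1 : η < 1) (hg : c < g) (hlk : 1 ≤ lk) (hΛ : κ ≤ Λ)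
    (hlog : Real.log (c⁻¹ * lk) ≤ Λ) (hτ : τ = c1 * η ^ 2 * g / (2 * lk)) {K : ℝ} (hK0 : 0 < K)
    (hK : K ≤ 2307 / (θ ^ 2 * τ)) :
    1 + Real.log K ≤ θ⁻¹ * (Λ ^ 2 / κ ^ 2) * (2312 + 2 / c1) := by
  have hη0 : 0 < η := hc0.trans hη
  have hg0 : 0 < g := hc0.trans hg
  have hlk0 : 0 < lk := by linarith
  have hτ0 : 0 < τ := by rw [hτ]; positivity
  have hΛ0 : 0 < Λ := by linarith
  have hle : K ≤ 2307 * (θ⁻¹ ^ 2 * ((2 / c1) * (c⁻¹ ^ 3 * lk))) := by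
    refine hK.trans ?_
    have e : 2307 / (θ ^ 2 * τ) = 2307 * (θ⁻¹ ^ 2 * ((2 / c1) * (η⁻¹ ^ 2 * g⁻¹ * lk))) := by
      rw [hτ]; field_simp
    have h1 : η⁻¹ ≤ c⁻¹ := inv_anti₀ hc0 hη.le
    have h2 : g⁻¹ ≤ c⁻¹ := inv_anti₀ hc0 hg.le
    rw [e, pow_succ c⁻¹ 2]
    gcongr
  have hinv : 0 < θ⁻¹ := by positivity
  have hcinv : 0 < c⁻¹ := by positivity
  have hlogK : Real.log K ≤ Real.log 2307 + (2 * Real.log θ⁻¹ +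
      (Real.log (2 / c1) + (3 * Real.log c⁻¹ + Real.log lk))) := by
    refine (Real.log_le_log hK0 hle).trans (le_of_eq ?_)
    rw [Real.log_mul (by positivity) (by positivity), Real.log_mul (by positivity) (by positivity),
      Real.log_mul (by positivity) (by positivity), Real.log_mul (by positivity) (by positivity),
      Real.log_pow, Real.log_pow]
    norm_num
  rw [Real.log_mul hcinv.ne' hlk0.ne'] at hlog
  have l1 : Real.log 2307 ≤ 2306 := by
    have := Real.log_le_sub_one_of_pos (show (0 : ℝ) < 2307 by norm_num)
    linarith
  have l2 := Real.log_le_sub_one_of_pos hinv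
  have l3 := Real.log_le_sub_one_of_pos (show 0 < 2 / c1 by positivity)
  have l4 : 0 ≤ Real.log lk := Real.log_nonneg hlk
  have hmain : 1 + Real.log K ≤ 2307 + 2 * θ⁻¹ + 2 / c1 + 3 * Λ := by linarith
  have hP : 1 ≤ θ⁻¹ := (one_le_inv₀ hθ0).2 hθ1
  have hQ : 1 ≤ Λ ^ 2 / κ ^ 2 := by
    rw [one_le_div (by positivity)]
    gcongr
  have hΛQ : Λ ≤ Λ ^ 2 / κ ^ 2 := by
    rw [le_div_iff₀ (by positivity), sq Λ]
    refine mul_le_mul_of_nonneg_left ?_ hΛ0.le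
    nlinarith
  set P := θ⁻¹
  set Q := Λ ^ 2 / κ ^ 2
  set R := 2 / c1 with hR
  have hR0 : 0 < R := by positivity
  have hPQ : P ≤ P * Q := by nlinarith
  have hQP : Q ≤ P * Q := by nlinarith
  nlinarith

/-- This calibrates the constant C: 12288 = 2 · 6144, the 2 coming from τ. Of the power θ⁻⁴, three
factors cancel θ³ and one pays for log K. -/
theorem grid_exponent_ge {c1 κ θ τ η g lk Λ n e : ℝ} (hc1 : 0 < c1) (hκ0 : 0 < κ) (hθ0 : 0 < θ)
    (hη0 : 0 < η) (hg0 : 0 < g) (hlk0 : 0 < lk) (hτ : τ = c1 * η ^ 2 * g / (2 * lk))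
    (he : 12288 / (c1 * κ ^ 2) * (2312 + 2 / c1) * η⁻¹ ^ 2 * g⁻¹ * θ⁻¹ ^ 4 * n * lk * Λ ^ 2 ≤ e) :
    n * (θ⁻¹ * (Λ ^ 2 / κ ^ 2) * (2312 + 2 / c1)) ≤ θ ^ 3 * τ * e / 6144 := by
  have hτ0 : 0 < τ := by rw [hτ]; positivity
  have h1 := mul_le_mul_of_nonneg_left he (show 0 ≤ θ ^ 3 * τ / 6144 by positivity)
  refine le_trans (le_of_eq ?_) (h1.trans (le_of_eq (by ring)))
  rw [hτ]
  field_simp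
  ring

theorem log_le_logb_two {y : ℝ} (hy : 1 ≤ y) : Real.log y ≤ Real.logb 2 y := by
  rw [Real.logb, le_div_iff₀ (Real.log_pos one_lt_two)]
  have h2 : Real.log 2 ≤ 1 := by
    have := Real.log_le_sub_one_of_pos (show (0 : ℝ) < 2 by norm_num)
    linarith
  nlinarith [Real.log_nonneg hy]

theorem one_le_logb_two_natCast {k : ℕ} (hk : 2 ≤ k) : 1 ≤ Real.logb 2 k := by
  rw [Real.le_logb_iff_rpow_le one_lt_two (by positivity), Real.rpow_one]
  exact_mod_cast hk

/-- For k ≥ 3 the bounds 3² ≥ 8 and (3/2)² ≥ 2 give the value 1/2; otherwise log(1/c) ≥ 1 - c. In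
the excluded case, k = 2 with c near 1, the logarithm can be arbitrarily small. -/
theorem le_logb_two_inv_mul_logb {c κ : ℝ} (hc0 : 0 < c) (hc1 : c < 1) (hκ : κ ≤ 1 / 2) {k : ℕ}
    (hk : 2 ≤ k) (h : 3 ≤ k ∨ c ≤ 1 - κ) : κ ≤ Real.logb 2 (c⁻¹ * Real.logb 2 k) := by
  have hlk := one_le_logb_two_natCast hk
  have hcinv : 1 ≤ c⁻¹ := (one_le_inv₀ hc0).2 hc1.le
  rcases h with h | h
  · have h1 : (3 / 2 : ℝ) ≤ Real.logb 2 k := by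
      have h8 : Real.logb 2 8 = 3 := by
        rw [show (8 : ℝ) = 2 ^ (3 : ℕ) by norm_num, Real.logb_pow, Real.logb_self_eq_one one_lt_two]
        norm_num
      have hk3 : (3 : ℝ) ≤ k := by exact_mod_cast h
      have hsq : Real.logb 2 ((k : ℝ) ^ 2) = 2 * Real.logb 2 k := by
        rw [Real.logb_pow]; norm_num
      have := Real.logb_le_logb_of_le one_lt_two (show (0 : ℝ) < 8 by norm_num)
        (show (8 : ℝ) ≤ (k : ℝ) ^ 2 by nlinarith)
      linarith
    have h2 : (1 / 2 : ℝ) ≤ Real.logb 2 (3 / 2) := by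
      have hsq : Real.logb 2 ((3 / 2 : ℝ) ^ 2) = 2 * Real.logb 2 (3 / 2) := by
        rw [Real.logb_pow]; norm_num
      have := Real.logb_le_logb_of_le one_lt_two (show (0 : ℝ) < 2 by norm_num)
        (show (2 : ℝ) ≤ (3 / 2 : ℝ) ^ 2 by norm_num)
      rw [Real.logb_self_eq_one one_lt_two] at this
      linarith
    have h3 := Real.logb_le_logb_of_le one_lt_two (show (0 : ℝ) < 3 / 2 by norm_num)
      (show 3 / 2 ≤ c⁻¹ * Real.logb 2 k by nlinarith)
    linarith
  · have h1 : Real.log c⁻¹ ≤ Real.logb 2 c⁻¹ := log_le_logb_two hcinv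
    have h2 := Real.logb_le_logb_of_le one_lt_two (show 0 < c⁻¹ by positivity)
      (show c⁻¹ ≤ c⁻¹ * Real.logb 2 k by nlinarith)
    rw [Real.log_inv] at h1
    have h3 := Real.log_le_sub_one_of_pos hc0
    linarith

/-- The random set is unlikely to be much larger than expected. -/
theorem setBernoulli_real_card_le {α : Type*} [Finite α] (E : Finset α) (p : unitInterval) {s : ℝ}
    (hs0 : 0 < s) (hs1 : s ≤ 1) :
    (ProbabilityTheory.setBernoulli (E : Set α) p).real
      {F | (p + s) * E.card ≤ ∑ e ∈ E, F.indicator (fun _ => (1 : ℝ)) e} ≤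
        Real.exp (-(s ^ 2 / 4 * E.card)) := by
  have h := setBernoulli_real_excess_le E p hs0 hs1 one_pos (fun _ => 1) (fun _ => zero_le_one)
    (fun _ => le_rfl) (s / 2 * E.card)
  have hset : {F : Set α | (p + s) * E.card ≤ ∑ e ∈ E, F.indicator (fun _ => (1 : ℝ)) e} =
      {F | s / 2 * E.card ≤ ∑ e ∈ E, (F.indicator (fun _ => (1 : ℝ)) e - (p + s / 2)) * 1} := by
    ext F
    simp only [Set.mem_ofPred_eq, mul_one, Finset.sum_sub_distrib, Finset.sum_const, nsmul_eq_mul]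
    constructor <;> intro h <;> linarith
  rw [hset]
  refine h.trans (le_of_eq ?_)
  congr 1
  ring

end Estimates

/-! ### Assembly of the main theorem -/

theorem mainTheorem2 (cstar : ℝ) (hcstar : 0 < cstar) :
    ∃ C : ℝ, 0 < C ∧ ∀ c : ℝ, 0 < c → c < 1 →
      ∃ δ : ℕ → ℝ, Filter.Tendsto δ Filter.atTop (nhds 0) ∧
        ∀ (n k : ℕ) [NeZero k] (ε : unitInterval) (η γ : ℝ) (G : SimpleGraph (Fin n)),
          2 ≤ k → 0 < (ε : ℝ) → (ε : ℝ) < 1 / 3 → c < η → η < 1 → (ε : ℝ) + c < γ → γ < 1 →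
          C * η⁻¹ ^ 2 * (γ - ε)⁻¹ * (1 / 3 - (ε : ℝ))⁻¹ ^ 4 * n * Real.logb 2 k *
              Real.logb 2 (c⁻¹ * Real.logb 2 k) ^ 2 ≤ (G.edgeSet.ncard : ℝ) →
          ∀ I : UniqueGame G k, I.SatisfiedBy (fun _ => 0) →
            1 - δ n ≤ (ProbabilityTheory.setBernoulli G.edgeSet ε).real
              {F | ∀ J : UniqueGame G k, I.IsCorruption F J →
                ∀ (d : ℕ) (x : Fin n → Fin k → EuclideanSpace ℝ (Fin d)), J.CrudeOptimal x →
                  (1 - γ) * (G.edgeSet.ncard : ℝ) ≤ ((J.superShortZero cstar η x).ncard : ℝ)} := by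
  classical
  obtain ⟨c1, hc1, hc1', hc1s⟩ : ∃ c1 : ℝ, 0 < c1 ∧ c1 ≤ 1 ∧ c1 ≤ cstar :=
    ⟨min cstar 1, lt_min hcstar one_pos, min_le_right _ _, min_le_left _ _⟩
  obtain ⟨κ, hκ⟩ : ∃ κ : ℝ, κ = c1 / 256 := ⟨_, rfl⟩
  have hκ0 : 0 < κ := by rw [hκ]; positivity
  obtain ⟨C, hC⟩ : ∃ C : ℝ, C = 12288 / (c1 * κ ^ 2) * (2312 + 2 / c1) := ⟨_, rfl⟩
  have hC0 : 0 < C := by rw [hC]; positivity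
  refine ⟨C, hC0, fun c hc0 hc_lt => ?_⟩
  -- The slack `s` in the size of the random set costs at most half of γ - ε; the bound c1/512
  -- serves the case k = 2 with c near 1.
  obtain ⟨s, hs0, hsc, hsc1⟩ : ∃ s : ℝ, 0 < s ∧ s ≤ c / 2 ∧ s ≤ c1 / 512 :=
    ⟨min (c / 2) (c1 / 512), lt_min (by positivity) (by positivity), min_le_left _ _,
      min_le_right _ _⟩
  have hcinv : 1 < c⁻¹ := (one_lt_inv₀ hc0).2 hc_lt
  have hΛ0 : 0 < Real.logb 2 c⁻¹ := Real.logb_pos one_lt_two hcinv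
  set Λ₀ := Real.logb 2 c⁻¹
  refine ⟨fun n => Real.exp (-((1 : ℝ) * n)) + Real.exp (-(s ^ 2 / 4 * (C * Λ₀ ^ 2) * n)), ?_, ?_⟩
  · have hlim : ∀ a : ℝ, 0 < a →
        Filter.Tendsto (fun n : ℕ => Real.exp (-(a * n))) Filter.atTop (nhds 0) := fun a ha =>
      Real.tendsto_exp_neg_atTop_nhds_zero.comp
        (Filter.Tendsto.const_mul_atTop ha tendsto_natCast_atTop_atTop)
    simpa using (hlim 1 one_pos).add (hlim (s ^ 2 / 4 * (C * Λ₀ ^ 2)) (by positivity))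
  intro n k _ ε η γ G hk hε0 hε1 hη hη1 hγ hγ1 hE I hI
  set E := G.edgeSet.toFinset with hEdef
  have hcard : G.edgeSet.ncard = E.card := Set.ncard_eq_toFinset_card' _
  have hEset : G.edgeSet = (E : Set (Sym2 (Fin n))) := by rw [hEdef, Set.coe_toFinset]
  have hη0 : 0 < η := hc0.trans hη
  have hlk := one_le_logb_two_natCast hk
  set lk := Real.logb 2 (k : ℝ) with hlkdef
  have hlk0 : 0 < lk := by linarith
  set Λ := Real.logb 2 (c⁻¹ * lk) with hΛdef
  obtain ⟨g, hgdef⟩ : ∃ g : ℝ, g = γ - ε := ⟨_, rfl⟩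
  obtain ⟨θ, hθdef⟩ : ∃ θ : ℝ, θ = 1 / 3 - (ε : ℝ) := ⟨_, rfl⟩
  have hg : c < g := by linarith
  have hg0 : 0 < g := by linarith
  have hg1 : g < 1 := by linarith
  have hθ0 : 0 < θ := by linarith
  have hθ1 : θ ≤ 1 := by linarith
  rw [hcard, ← hgdef, ← hθdef] at hE
  have hn0 : (0 : ℝ) ≤ n := Nat.cast_nonneg n
  -- A bound linear in n whose coefficient involves only cstar and c, as δ requires.
  have hEn : C * Λ₀ ^ 2 * n ≤ E.card := by
    have h1 : 1 ≤ η⁻¹ ^ 2 := one_le_pow₀ ((one_le_inv₀ hη0).2 hη1.le)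
    have h2 : 1 ≤ g⁻¹ := (one_le_inv₀ hg0).2 hg1.le
    have h3 : 1 ≤ θ⁻¹ ^ 4 := one_le_pow₀ ((one_le_inv₀ hθ0).2 hθ1)
    have h4 : Λ₀ ≤ Λ := Real.logb_le_logb_of_le one_lt_two (by positivity)
      (le_mul_of_one_le_right (by positivity) hlk)
    calc C * Λ₀ ^ 2 * n = C * 1 * 1 * 1 * n * 1 * Λ₀ ^ 2 := by ring
      _ ≤ C * η⁻¹ ^ 2 * g⁻¹ * θ⁻¹ ^ 4 * n * lk * Λ ^ 2 := by gcongr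
      _ ≤ E.card := hE
  obtain ⟨τ, hτ⟩ : ∃ τ : ℝ, τ = c1 * η ^ 2 * g / (2 * lk) := ⟨_, rfl⟩
  have hτ0 : 0 < τ := by rw [hτ]; positivity
  have hτ1 : τ ≤ 1 := by
    rw [hτ, div_le_one (by positivity)]
    calc c1 * η ^ 2 * g ≤ 1 * 1 ^ 2 * 1 := by gcongr
      _ ≤ 2 * lk := by linarith
  set μ := ProbabilityTheory.setBernoulli G.edgeSet ε with hμ
  set A : Set (Set (Sym2 (Fin n))) :=
    {F | (ε + s) * E.card ≤ ∑ e ∈ E, F.indicator (fun _ => (1 : ℝ)) e} with hA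
  have hA' : ∀ F ∉ A, ∑ e ∈ E, F.indicator (fun _ => (1 : ℝ)) e < (ε + s) * E.card := by
    intro F hF
    rwa [hA, Set.mem_ofPred_eq, not_le] at hF
  have hμA : μ.real A ≤ Real.exp (-(s ^ 2 / 4 * (C * Λ₀ ^ 2) * n)) := by
    rw [hμ, hEset]
    refine (setBernoulli_real_card_le E ε hs0 (by linarith)).trans (Real.exp_le_exp.2 ?_)
    have := mul_le_mul_of_nonneg_left hEn (show 0 ≤ s ^ 2 / 4 by positivity)
    linarith
  -- an atypical solution has a long zero layer, one third of which is corrupted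
  have hdet : ∀ F ∉ A, ∀ J : UniqueGame G k, I.IsCorruption F J →
      ∀ (d : ℕ) (x : Fin n → Fin k → EuclideanSpace ℝ (Fin d)), J.CrudeOptimal x →
        ((J.superShortZero cstar η x).ncard : ℝ) < (1 - γ) * E.card →
        τ * E.card ≤ ∑ e ∈ E, edgeSq (fun u => x u 0) e ∧
        0 ≤ ∑ e ∈ E, (F.indicator (fun _ => (1 : ℝ)) e - 1 / 3) * edgeSq (fun u => x u 0) e := by
    intro F hF J hJ d x hx hlt
    refine ⟨le_trans ?_ (UniqueGame.mul_card_sub_le_sum_edgeSq hI hJ x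
      (t := c1 * η ^ 2 / lk) (cstar := cstar) (η := η) (by positivity) (by gcongr)),
      hx.sum_edgeSq_nonneg hI hJ⟩
    have hF' := hA' F hF
    -- More than (γ - ε - s)|E| ≥ (g/2)|E| zero-layer edges are neither corrupted nor short.
    have e1 : τ * E.card = c1 * η ^ 2 / lk * (g / 2 * E.card) := by
      rw [hτ]; ring
    rw [e1]
    refine mul_le_mul_of_nonneg_left ?_ (by positivity)
    have : g / 2 * E.card ≤ (g - s) * E.card :=
      mul_le_mul_of_nonneg_right (by linarith) (Nat.cast_nonneg _)
    rw [hgdef] at this ⊢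
    linarith
  suffices hB : ∃ B : Set (Set (Sym2 (Fin n))), μ.real B ≤ Real.exp (-((1 : ℝ) * n)) ∧
      ∀ F, F ∉ A → F ∉ B → ∀ J : UniqueGame G k, I.IsCorruption F J →
      ∀ (d : ℕ) (x : Fin n → Fin k → EuclideanSpace ℝ (Fin d)), J.CrudeOptimal x →
        (1 - γ) * (E.card : ℝ) ≤ ((J.superShortZero cstar η x).ncard : ℝ) by
    obtain ⟨B, hμB, hgood⟩ := hB
    rw [hcard]
    set S := {F : Set (Sym2 (Fin n)) | ∀ J : UniqueGame G k, I.IsCorruption F J →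
      ∀ (d : ℕ) (x : Fin n → Fin k → EuclideanSpace ℝ (Fin d)), J.CrudeOptimal x →
        (1 - γ) * (E.card : ℝ) ≤ ((J.superShortZero cstar η x).ncard : ℝ)}
    have hcover : (Set.univ : Set (Set (Sym2 (Fin n)))) ⊆ S ∪ (A ∪ B) := by
      intro F _
      by_cases hFA : F ∈ A
      · exact Or.inr (Or.inl hFA)
      · by_cases hFB : F ∈ B
        · exact Or.inr (Or.inr hFB)
        · exact Or.inl (hgood F hFA hFB)
    have h1 := MeasureTheory.measureReal_mono (μ := μ) hcover
    rw [MeasureTheory.probReal_univ] at h1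
    have h2 := MeasureTheory.measureReal_union_le (μ := μ) S (A ∪ B)
    have h3 := MeasureTheory.measureReal_union_le (μ := μ) A B
    linarith
  -- Outside this case Λ may be close to 0, and the edge hypothesis no longer pays for the union
  -- bound.
  by_cases hcase : 3 ≤ k ∨ c ≤ 1 - κ
  · have hΛκ : κ ≤ Λ := le_logb_two_inv_mul_logb hc0 hc_lt (by linarith) hk hcase
    have hlog : Real.log (c⁻¹ * lk) ≤ Λ := log_le_logb_two (by nlinarith)
    obtain ⟨B, hμB, hB⟩ := exists_unlikely_of_unit_vectors E ε hθ0 hθ1 (by linarith) hτ0 hτ1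
      fun K hK0 hK => by
        rw [Fintype.card_fin]
        exact (mul_le_mul_of_nonneg_left (one_add_log_grid_le hc1 hκ0 (by linarith) hθ0 hθ1 hc0 hη
          hη1 hg hlk hΛκ hlog hτ hK0 hK) hn0).trans
            (grid_exponent_ge hc1 hκ0 hθ0 hη0 hg0 hlk0 hτ (hC ▸ hE))
    rw [Fintype.card_fin] at hμB
    refine ⟨B, by rwa [hμ, hEset, one_mul], fun F hFA hFB J hJ d x hx => ?_⟩
    by_contra hlt
    obtain ⟨hL, hpos⟩ := hdet F hFA J hJ d x hx (not_le.1 hlt)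
    have h1 := hB F hFB d (fun u => x u 0) (fun u => hx.1.norm_eq_one u 0) hL
    -- Since ε + θ/2 = 1/3 - θ/2, carrying a third of the length is a surplus of θ/2 over the
    -- threshold.
    have e1 : ∑ e ∈ E, (F.indicator (fun _ => (1 : ℝ)) e - (ε + θ / 2)) *
        edgeSq (fun u => x u 0) e =
        ∑ e ∈ E, (F.indicator (fun _ => (1 : ℝ)) e - 1 / 3) * edgeSq (fun u => x u 0) e +
          θ / 2 * ∑ e ∈ E, edgeSq (fun u => x u 0) e := by
      rw [Finset.mul_sum, ← Finset.sum_add_distrib]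
      refine Finset.sum_congr rfl fun e _ => ?_
      rw [hθdef]
      ring
    linarith
  · obtain ⟨hk3, hcκ⟩ := not_or.1 hcase
    have hk2 : k = 2 := by omega
    have hlk1 : lk = 1 := by
      rw [hlkdef, hk2]
      exact Real.logb_self_eq_one one_lt_two
    refine ⟨∅, by simpa using (Real.exp_pos _).le, fun F hFA _ J hJ d x hx => ?_⟩
    by_contra hlt
    obtain ⟨hL, hpos⟩ := hdet F hFA J hJ d x hx (not_le.1 hlt)
    have hFA' := hA' F hFA
    have hd : ∀ e, edgeSq (fun u => x u 0) e ≤ 4 * 1 ^ 2 :=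
      edgeSq_le _ fun u => (hx.1.norm_eq_one u 0).le
    -- Corrupted edges carry a third of the length and have squared length at most 4 each.
    have h1 : ∑ e ∈ E, edgeSq (fun u => x u 0) e ≤
        12 * ∑ e ∈ E, F.indicator (fun _ => (1 : ℝ)) e := by
      have h2 : ∑ e ∈ E, (F.indicator (fun _ => (1 : ℝ)) e - 1 / 3) * edgeSq (fun u => x u 0) e ≤
          ∑ e ∈ E, (4 * F.indicator (fun _ => (1 : ℝ)) e - 1 / 3 * edgeSq (fun u => x u 0) e) := by
        refine Finset.sum_le_sum fun e _ => ?_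
        by_cases he : e ∈ F
        · rw [Set.indicator_of_mem he]
          linarith [hd e]
        · rw [Set.indicator_of_notMem he]
          linarith
      rw [Finset.sum_sub_distrib, ← Finset.mul_sum, ← Finset.mul_sum] at h2
      linarith
    have hc255 : 255 / 256 ≤ c := by linarith
    have hτge : c1 / 4 ≤ τ := by
      have h3 : (255 / 256 : ℝ) ^ 2 * (255 / 256) ≤ η ^ 2 * g := by
        gcongr <;> linarith
      have h4 := mul_le_mul_of_nonneg_left h3 hc1.le
      rw [hτ, hlk1]
      linarith
    -- Here ε < γ - c < 1 - c < κ = c1/256 and s ≤ c1/512, so the left side is below c1/4.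
    have h4 : 12 * (ε + s) ≤ τ := by linarith
    have h5 := mul_le_mul_of_nonneg_right h4 (Nat.cast_nonneg (α := ℝ) E.card)
    linarith
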